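/- Let $G(x,y)=\sum_{i,j\ge 0} g_{ij}x^iy^j$ be a formal power series with real coefficients such that the equation $y=G(x,y)$ is \emph{well-conditioned}, that is: (a) all $g_{ij}\ge 0$; (b) $G$ is holomorphic in a neighborhood of the origin of $\mathbb{C}^2$; (c) $G(0,y)=0$; (d) $G(x,0)\neq 0$; (e) $1-G_y(0,0)\neq 0$; (f) $G_y\neq 0$; (g) $G_{yy}\neq 0$. Here $G_y=\partial G/\partial y$ and $G_{yy}$ denote formal partial derivatives. A \emph{characteristic point} of the equation is a pair $(a,b)$ of positive real numbers such that the series $G$ and $G_y$ converge at $(a,b)$ and $$b=G(a,b),\qquad 1=G_y(a,b);$$ it may lie in the interior or on the boundary of the domain of convergence of $G$. Then the equation has at most one characteristic point. Moreover, there is a unique formal power series $T(x)$ with nonnegative coefficients and $T(0)=0$ that satisfies the formal identity $T(x)=G(x,T(x))$ (the \emph{standard solution}), and if $(a,b)$ is a characteristic point, then $(a,b)$ is the \emph{extreme point} $(\rho,\tau)$ of $T$: $a=\rho$ is the radius of convergence of $T$, and $T$ converges at $\rho$ with $b=\tau=T(\rho)$. -/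

import Mathlib

/-!
One-equation systems `y = G(x, y)`, where `G` is a formal power series in two variables with
real coefficients. The variable with index `0` is `x` and the variable with index `1` is `y`.
-/

noncomputable section

namespace OneEq

/-- The power series `F(x, y)` converges at `(a, b)`, as an unconditional sum, to the value `v`. -/
def HasValue (F : MvPowerSeries (Fin 2) ℝ) (a b v : ℝ) : Prop :=
  HasSum (fun d : Fin 2 →₀ ℕ => MvPowerSeries.coeff d F * a ^ d 0 * b ^ d 1) v

/-- The formal partial derivative `∂F/∂y`. For a single equation `y = G(x, y)` this is the
Jacobian `J_G`, a `1 × 1` matrix. -/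
def dy (F : MvPowerSeries (Fin 2) ℝ) : MvPowerSeries (Fin 2) ℝ :=
  MvPowerSeries.pderiv ℝ 1 F

/-- The equation `y = G(x, y)` is well-conditioned. -/
structure WellConditioned (G : MvPowerSeries (Fin 2) ℝ) : Prop where
  /-- `G` has nonnegative coefficients -/
  nonneg : ∀ d, 0 ≤ MvPowerSeries.coeff d G
  /-- `G` defines a holomorphic function near the origin: the power series converges on some
  complex polydisc centered at the origin -/
  holomorphic : ∃ r : ℝ, 0 < r ∧ ∀ x y : ℂ, ‖x‖ < r → ‖y‖ < r →
    Summable fun d : Fin 2 →₀ ℕ => ((MvPowerSeries.coeff d G : ℝ) : ℂ) * x ^ d 0 * y ^ d 1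
  /-- `G(0, y) = 0` -/
  zero_left : ∀ n : ℕ, MvPowerSeries.coeff (Finsupp.single 1 n) G = 0
  /-- `G(x, 0) ≠ 0` -/
  zero_right : ∃ n : ℕ, MvPowerSeries.coeff (Finsupp.single 0 n) G ≠ 0
  /-- `det (I - J_G(0, 0)) ≠ 0` -/
  det_ne_zero : 1 - MvPowerSeries.constantCoeff (dy G) ≠ 0
  /-- the system is irreducible: the `1 × 1` matrix `J_G` is not zero -/
  irreducible : dy G ≠ 0
  /-- `∂²G/∂y² ≠ 0`, so the equation is nonlinear in `y` -/
  nonlinear : dy (dy G) ≠ 0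

/-- `T` is a standard solution of `y = G(x, y)`: a formal power series with nonnegative
coefficients and zero constant term (so that the composition is defined) that satisfies the
formal identity `T(x) = G(x, T(x))`. -/
structure IsStandardSolution (G : MvPowerSeries (Fin 2) ℝ) (T : PowerSeries ℝ) : Prop where
  nonneg : ∀ n, 0 ≤ PowerSeries.coeff n T
  constantCoeff_eq_zero : PowerSeries.constantCoeff T = 0
  eq_subst : T = MvPowerSeries.subst (![PowerSeries.X, T] : Fin 2 → PowerSeries ℝ) G

/-- `(ρ, τ)` is the extreme point of `T`: the radius of convergence of `T` is the positive real
number `ρ`, and `T` converges at `ρ` to `τ`. -/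
structure IsExtremePoint (T : PowerSeries ℝ) (ρ τ : ℝ) : Prop where
  pos : 0 < ρ
  radius_eq : (FormalMultilinearSeries.ofScalars ℝ fun n => PowerSeries.coeff n T).radius
    = ENNReal.ofReal ρ
  hasSum : HasSum (fun n => PowerSeries.coeff n T * ρ ^ n) τ

/-- The characteristic points of `y = G(x, y)`: the positive solutions `(a, b)` of the
characteristic system `y = G(x, y)`, `0 = 1 - G_y(x, y)`. They may lie in the interior or on the
boundary of the positive domain of `G`; the derivative is the formal one. -/
def charPoints (G : MvPowerSeries (Fin 2) ℝ) : Set (ℝ × ℝ) :=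
  {p | 0 < p.1 ∧ 0 < p.2 ∧ HasValue G p.1 p.2 p.2 ∧ HasValue (dy G) p.1 p.2 1}

end OneEq

end

/-!
Modulo `X ^ (n + 1)`, the series `G(x, T(x))` depends only on `T` modulo `X ^ n`, because `x`
divides `G`. So `T ↦ G(x, T(x))` has a unique fixed point, which lies in every `X`-adically closed
set that the operator maps to itself. Applied to the sets `T(x) ≤ y`, where `G(x, y) ≤ y`, this
makes `T(x)` the least solution `y` of `y = G(x, y)` in `[0, ∞]`.

If `(a, b)` is a characteristic point, then the diagonal is tangent to the graph of the strictly
convex function `G(a, ·)` at `b`, and thus `y < G(a, y)` for all other `y ≥ 0`. Since `T(a) ≤ b` is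
a solution, `T(a) = b`. At `x > a`, a finite value `y = T(x) > b` would give
`y < G(a, y) ≤ G(x, y) = y`.
-/

open scoped ENNReal NNReal PowerSeries

namespace OneEq

section AdicFixedPoint

variable {A M : Type*} [CommRing A] [AddCommGroup M] [Module A M] {I : Ideal A} {Φ : M → M}
  {s t : Set M}

/-- The operator `Φ` is a contraction on `s` for the `I`-adic topology: points that are congruent
modulo `I ^ n` have images that are congruent modulo `I ^ (n + 1)`. -/
def AdicContractingOn (I : Ideal A) (Φ : M → M) (s : Set M) : Prop :=
  ∀ n : ℕ, ∀ x ∈ s, ∀ y ∈ s, x ≡ y [SMOD (I ^ n • ⊤ : Submodule A M)] →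
    Φ x ≡ Φ y [SMOD (I ^ (n + 1) • ⊤ : Submodule A M)]

/-- The set `s` is closed in the `I`-adic topology: it contains each point that is congruent to
elements of `s` modulo all powers of `I`. -/
def IsAdicClosed (I : Ideal A) (s : Set M) : Prop :=
  ∀ x : M, (∀ n : ℕ, ∃ y ∈ s, x ≡ y [SMOD (I ^ n • ⊤ : Submodule A M)]) → x ∈ s

theorem AdicContractingOn.mono (hΦ : AdicContractingOn I Φ t) (hst : s ⊆ t) :
    AdicContractingOn I Φ s :=
  fun n x hx y hy => hΦ n x (hst hx) y (hst hy)

theorem AdicContractingOn.eq_of_isFixedPt [IsHausdorff I M] (hΦ : AdicContractingOn I Φ s)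
    {x y : M} (hx : x ∈ s) (hy : y ∈ s) (hΦx : Φ.IsFixedPt x) (hΦy : Φ.IsFixedPt y) : x = y := by
  refine (IsHausdorff.eq_iff_smodEq (I := I)).2 fun n => ?_
  induction n with
  | zero => simp [SModEq.top]
  | succ n ih => simpa only [hΦx.eq, hΦy.eq] using hΦ n x hx y hy ih

theorem AdicContractingOn.exists_isFixedPt [IsAdicComplete I M] (hΦ : AdicContractingOn I Φ s)
    (hs : IsAdicClosed I s) (hne : s.Nonempty) (hmaps : Set.MapsTo Φ s s) :
    ∃ x ∈ s, Φ.IsFixedPt x := by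
  obtain ⟨x₀, hx₀⟩ := hne
  have hmem (n : ℕ) : Φ^[n] x₀ ∈ s := hmaps.iterate n hx₀
  have hstep (n : ℕ) : Φ^[n] x₀ ≡ Φ^[n + 1] x₀ [SMOD (I ^ n • ⊤ : Submodule A M)] := by
    induction n with
    | zero => simp [SModEq.top]
    | succ n ih =>
      simpa only [Function.iterate_succ_apply'] using hΦ n _ (hmem n) _ (hmem (n + 1)) ih
  have hcauchy {m n : ℕ} (hmn : m ≤ n) :
      Φ^[m] x₀ ≡ Φ^[n] x₀ [SMOD (I ^ m • ⊤ : Submodule A M)] := by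
    induction n, hmn using Nat.le_induction with
    | base => rfl
    | succ n hmn ih =>
      exact ih.trans ((hstep n).mono (Submodule.smul_mono_left (Ideal.pow_le_pow_right hmn)))
  obtain ⟨x, hlim⟩ := IsPrecomplete.prec' (I := I) _ hcauchy
  have hx : x ∈ s := hs x fun n => ⟨_, hmem n, (hlim n).symm⟩
  refine ⟨x, hx, (IsHausdorff.eq_iff_smodEq (I := I)).2 fun n => ?_⟩
  have hΦlim := hΦ n _ (hmem n) x hx (hlim n)
  rw [← Function.iterate_succ_apply' Φ n x₀] at hΦlim
  exact (hΦlim.symm.trans (hlim (n + 1))).mono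
    (Submodule.smul_mono_left (Ideal.pow_le_pow_right n.le_succ))

end AdicFixedPoint

section Substitution

variable {σ R S : Type*} [CommRing R] [CommRing S]

theorem smodEq_span_X_pow_iff {T T' : R⟦X⟧} {n : ℕ} :
    T ≡ T' [SMOD (Ideal.span {(PowerSeries.X : R⟦X⟧)} ^ n • ⊤ : Submodule R⟦X⟧ R⟦X⟧)] ↔
      PowerSeries.X ^ n ∣ T - T' := by
  rw [SModEq.sub_mem, smul_eq_mul, Ideal.mul_top, Ideal.span_singleton_pow,
    Ideal.mem_span_singleton]

theorem coeff_eq_of_X_pow_dvd_sub {T T' : R⟦X⟧} {m n : ℕ} (h : PowerSeries.X ^ n ∣ T - T')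
    (hmn : m < n) : PowerSeries.coeff m T = PowerSeries.coeff m T' := by
  rw [← sub_eq_zero, ← map_sub]
  exact PowerSeries.X_pow_dvd_iff.1 h m hmn

theorem X_pow_dvd_subst_sub_subst [Algebra R S] {a b : σ → S⟦X⟧} (ha : MvPowerSeries.HasSubst a)
    (hb : MvPowerSeries.HasSubst b) {n : ℕ} (h : ∀ s, PowerSeries.X ^ n ∣ a s - b s)
    (F : MvPowerSeries σ R) :
    (PowerSeries.X : S⟦X⟧) ^ n ∣ MvPowerSeries.subst a F - MvPowerSeries.subst b F := by
  have hmonomial (d : σ →₀ ℕ) :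
      (PowerSeries.X : S⟦X⟧) ^ n ∣ (d.prod fun s e => a s ^ e) - d.prod fun s e => b s ^ e := by
    simp only [← Ideal.mem_span_singleton, ← Ideal.Quotient.eq, map_finsuppProd, map_pow] at h ⊢
    simp only [h]
  refine PowerSeries.X_pow_dvd_iff.2 fun m hm => ?_
  rw [map_sub, sub_eq_zero]
  refine (MvPowerSeries.coeff_subst ha F _).trans ((finsum_congr fun d => ?_).trans
    (MvPowerSeries.coeff_subst hb F _).symm)
  exact congrArg _ (coeff_eq_of_X_pow_dvd_sub (hmonomial d) hm)

/-- The operator `T(x) ↦ G(x, T(x))` on formal power series. It is meaningful when the constant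
coefficient of `T` is nilpotent; otherwise `MvPowerSeries.subst` returns a junk value. -/
noncomputable def substSnd (G : MvPowerSeries (Fin 2) R) (T : R⟦X⟧) : R⟦X⟧ :=
  MvPowerSeries.subst (![PowerSeries.X, T] : Fin 2 → R⟦X⟧) G

theorem hasSubst_X_cons {T : R⟦X⟧} (hT : PowerSeries.constantCoeff T = 0) :
    MvPowerSeries.HasSubst (![PowerSeries.X, T] : Fin 2 → R⟦X⟧) :=
  MvPowerSeries.hasSubst_of_constantCoeff_zero <|
    Fin.forall_fin_two.2 ⟨PowerSeries.constantCoeff_X, hT⟩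

variable {G : MvPowerSeries (Fin 2) R}

theorem substSnd_X_zero_mul (H : MvPowerSeries (Fin 2) R) {T : R⟦X⟧}
    (hT : PowerSeries.constantCoeff T = 0) :
    substSnd (MvPowerSeries.X 0 * H) T = PowerSeries.X * substSnd H T := by
  rw [substSnd, MvPowerSeries.subst_mul (hasSubst_X_cons hT),
    MvPowerSeries.subst_X (hasSubst_X_cons hT)]
  rfl

theorem constantCoeff_substSnd (hG : MvPowerSeries.X 0 ∣ G) {T : R⟦X⟧}
    (hT : PowerSeries.constantCoeff T = 0) : PowerSeries.constantCoeff (substSnd G T) = 0 := by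
  obtain ⟨H, rfl⟩ := hG
  rw [substSnd_X_zero_mul H hT, map_mul, PowerSeries.constantCoeff_X, zero_mul]

theorem adicContractingOn_substSnd (hG : MvPowerSeries.X 0 ∣ G) :
    AdicContractingOn (Ideal.span {(PowerSeries.X : R⟦X⟧)}) (substSnd G)
      {T | PowerSeries.constantCoeff T = 0} := by
  intro n T hT T' hT' h
  obtain ⟨H, rfl⟩ := hG
  rw [smodEq_span_X_pow_iff] at h ⊢
  rw [substSnd_X_zero_mul H hT, substSnd_X_zero_mul H hT', ← mul_sub, pow_succ']
  refine mul_dvd_mul_left _ (X_pow_dvd_subst_sub_subst (hasSubst_X_cons hT) (hasSubst_X_cons hT')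
    (Fin.forall_fin_two.2 ⟨?_, h⟩) H)
  simp

end Substitution

section NonnegCoeffs

variable {σ τ R : Type*}

/-- The power series whose coefficients are all nonnegative. -/
def nonnegCoeffs (σ R : Type*) [Semiring R] [PartialOrder R] [IsOrderedRing R] :
    Subsemiring (MvPowerSeries σ R) where
  carrier := {F | ∀ d, 0 ≤ MvPowerSeries.coeff d F}
  zero_mem' d := (map_zero (MvPowerSeries.coeff d)).ge
  one_mem' d := by
    classical
    rw [MvPowerSeries.coeff_one]
    split_ifs
    exacts [zero_le_one, le_rfl]
  add_mem' hF hG d := (add_nonneg (hF d) (hG d)).trans_eq (map_add _ _ _).symm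
  mul_mem' hF hG d := by
    classical
    rw [MvPowerSeries.coeff_mul]
    exact Finset.sum_nonneg fun p _ => mul_nonneg (hF _) (hG _)

theorem X_mem_nonnegCoeffs [Semiring R] [PartialOrder R] [IsOrderedRing R] (s : σ) :
    MvPowerSeries.X s ∈ nonnegCoeffs σ R := by
  classical
  intro d
  rw [MvPowerSeries.coeff_X]
  split_ifs
  exacts [zero_le_one, le_rfl]

theorem mem_nonnegCoeffs_unit_iff [Semiring R] [PartialOrder R] [IsOrderedRing R] {T : R⟦X⟧} :
    T ∈ nonnegCoeffs Unit R ↔ ∀ n, 0 ≤ PowerSeries.coeff n T :=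
  (Finsupp.uniqueEquiv ()).symm.forall_congr_right.symm

theorem X_cons_mem_nonnegCoeffs [Semiring R] [PartialOrder R] [IsOrderedRing R] {T : R⟦X⟧}
    (hT : T ∈ nonnegCoeffs Unit R) :
    ∀ s, (![PowerSeries.X, T] : Fin 2 → R⟦X⟧) s ∈ nonnegCoeffs Unit R :=
  Fin.forall_fin_two.2 ⟨X_mem_nonnegCoeffs (), hT⟩

theorem finsuppProd_pow_mem_nonnegCoeffs [CommSemiring R] [PartialOrder R] [IsOrderedRing R]
    {a : σ → MvPowerSeries τ R}
    (ha : ∀ s, a s ∈ nonnegCoeffs τ R) (d : σ →₀ ℕ) :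
    (d.prod fun s e => a s ^ e) ∈ nonnegCoeffs τ R :=
  prod_mem fun s _ => pow_mem (ha s) _

theorem subst_mem_nonnegCoeffs [CommRing R] [PartialOrder R] [IsOrderedRing R]
    {F : MvPowerSeries σ R} {a : σ → MvPowerSeries τ R}
    (hF : F ∈ nonnegCoeffs σ R) (hsubst : MvPowerSeries.HasSubst a)
    (ha : ∀ s, a s ∈ nonnegCoeffs τ R) : MvPowerSeries.subst a F ∈ nonnegCoeffs τ R := by
  intro d
  rw [MvPowerSeries.coeff_subst hsubst]
  exact finsum_nonneg fun e => mul_nonneg (hF e) (finsuppProd_pow_mem_nonnegCoeffs ha e d)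

end NonnegCoeffs

section Evaluation

variable {σ τ : Type*}

/-- The value of a power series at a point of `[0, ∞]^σ`, where it always converges. Negative
coefficients count as `0`, so this is meant for series in `nonnegCoeffs σ ℝ`. -/
noncomputable def eval (F : MvPowerSeries σ ℝ) (x : σ → ℝ≥0∞) : ℝ≥0∞ :=
  ∑' d : σ →₀ ℕ, ENNReal.ofReal (MvPowerSeries.coeff d F) * d.prod fun s e => x s ^ e

theorem eval_mono (F : MvPowerSeries σ ℝ) : Monotone (eval F) := fun _ _ hxy =>
  ENNReal.tsum_le_tsum fun _ => mul_le_mul_right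
    (Finset.prod_le_prod' fun s _ => pow_le_pow_left' (hxy s) _) _

theorem eval_zero (x : σ → ℝ≥0∞) : eval 0 x = 0 := by
  simp [eval]

theorem eval_one (x : σ → ℝ≥0∞) : eval 1 x = 1 := by
  classical
  rw [eval, tsum_eq_single 0 fun d hd => by simp [MvPowerSeries.coeff_one, hd]]
  simp

theorem eval_X (s : σ) (x : σ → ℝ≥0∞) : eval (MvPowerSeries.X s) x = x s := by
  classical
  rw [eval, tsum_eq_single (Finsupp.single s 1) fun d hd => by simp [MvPowerSeries.coeff_X, hd]]
  simp

theorem ennreal_tsum_mul_tsum_eq_tsum_sum_antidiagonal {ι : Type*} [AddMonoid ι]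
    [Finset.HasAntidiagonal ι] (f g : ι → ℝ≥0∞) :
    (∑' i, f i) * ∑' j, g j = ∑' n, ∑ p ∈ Finset.HasAntidiagonal.antidiagonal n, f p.1 * g p.2 := by
  rw [← ENNReal.tsum_mul_right]
  simp only [← ENNReal.tsum_mul_left]
  rw [← ENNReal.tsum_prod (f := fun i j => f i * g j),
    ← Finset.HasAntidiagonal.sigmaAntidiagonalEquivProd.tsum_eq, ENNReal.tsum_sigma']
  refine tsum_congr fun n => ?_
  rw [tsum_fintype]
  exact Finset.sum_coe_sort _ fun p : ι × ι => f p.1 * g p.2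

theorem eval_mul {F G : MvPowerSeries σ ℝ} (hF : F ∈ nonnegCoeffs σ ℝ)
    (hG : G ∈ nonnegCoeffs σ ℝ) (x : σ → ℝ≥0∞) : eval (F * G) x = eval F x * eval G x := by
  classical
  rw [eval, eval, eval, ennreal_tsum_mul_tsum_eq_tsum_sum_antidiagonal]
  refine tsum_congr fun d => ?_
  rw [MvPowerSeries.coeff_mul, ENNReal.ofReal_sum_of_nonneg fun p _ => mul_nonneg (hF _) (hG _),
    Finset.sum_mul]
  refine Finset.sum_congr rfl fun p hp => ?_
  rw [← Finset.HasAntidiagonal.mem_antidiagonal.1 hp,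
    Finsupp.prod_add_index' (fun _ => pow_zero _) fun _ _ _ => pow_add _ _ _,
    ENNReal.ofReal_mul (hF _)]
  ring

/-- Evaluation at `x`, as a homomorphism of multiplicative monoids. -/
noncomputable def evalHom (x : σ → ℝ≥0∞) : nonnegCoeffs σ ℝ →* ℝ≥0∞ where
  toFun F := eval (F : MvPowerSeries σ ℝ) x
  map_one' := eval_one x
  map_mul' F G := eval_mul F.2 G.2 x

theorem eval_finsuppProd_pow {a : σ → MvPowerSeries τ ℝ} (ha : ∀ s, a s ∈ nonnegCoeffs τ ℝ)
    (d : σ →₀ ℕ) (x : τ → ℝ≥0∞) :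
    eval (d.prod fun s e => a s ^ e) x = d.prod fun s e => eval (a s) x ^ e := by
  have h := map_finsuppProd (evalHom x) d fun s e => (⟨a s, ha s⟩ : nonnegCoeffs τ ℝ) ^ e
  simp only [map_pow] at h
  simpa only [evalHom, MonoidHom.coe_mk, OneHom.coe_mk, Finsupp.prod,
    SubmonoidClass.coe_finsetProd, SubmonoidClass.coe_pow] using h

theorem eval_subst {F : MvPowerSeries σ ℝ} {a : σ → MvPowerSeries τ ℝ}
    (hF : F ∈ nonnegCoeffs σ ℝ) (hsubst : MvPowerSeries.HasSubst a)
    (ha : ∀ s, a s ∈ nonnegCoeffs τ ℝ) (x : τ → ℝ≥0∞) :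
    eval (MvPowerSeries.subst a F) x = eval F fun s => eval (a s) x := by
  have hcoeff (d : τ →₀ ℕ) : ENNReal.ofReal (MvPowerSeries.coeff d (MvPowerSeries.subst a F)) =
      ∑' e : σ →₀ ℕ, ENNReal.ofReal (MvPowerSeries.coeff e F) *
        ENNReal.ofReal (MvPowerSeries.coeff d (e.prod fun s k => a s ^ k)) := by
    have hfin := MvPowerSeries.coeff_subst_finite hsubst F d
    simp only [smul_eq_mul] at hfin
    simp only [MvPowerSeries.coeff_subst hsubst, smul_eq_mul]
    rw [← tsum_eq_finsum (L := .unconditional _) hfin,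
      ENNReal.ofReal_tsum_of_nonneg
        (fun e => mul_nonneg (hF e) (finsuppProd_pow_mem_nonnegCoeffs ha e d))
        (summable_of_hasFiniteSupport hfin)]
    exact tsum_congr fun e => ENNReal.ofReal_mul (hF e)
  calc eval (MvPowerSeries.subst a F) x
      = ∑' e, ENNReal.ofReal (MvPowerSeries.coeff e F) *
          eval (e.prod fun s k => a s ^ k) x := by
        simp only [eval, hcoeff, ← ENNReal.tsum_mul_right, ← ENNReal.tsum_mul_left, mul_assoc]
        exact ENNReal.tsum_comm
    _ = eval F fun s => eval (a s) x := by
        simp only [eval_finsuppProd_pow ha]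
        rfl

theorem hasSum_iff_tsum_ofReal {ι : Type*} {f : ι → ℝ} (hf : ∀ i, 0 ≤ f i) {v : ℝ} (hv : 0 ≤ v) :
    HasSum f v ↔ ∑' i, ENNReal.ofReal (f i) = ENNReal.ofReal v := by
  refine ⟨fun h => by rw [← ENNReal.ofReal_tsum_of_nonneg hf h.summable, h.tsum_eq], fun h => ?_⟩
  have hsum : Summable f := by
    simpa only [ENNReal.toReal_ofReal (hf _)] using
      ENNReal.summable_toReal (h.trans_ne ENNReal.ofReal_ne_top)
  rw [← ENNReal.ofReal_tsum_of_nonneg hf hsum,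
    ENNReal.ofReal_eq_ofReal_iff (tsum_nonneg hf) hv] at h
  exact h ▸ hsum.hasSum

theorem hasSum_iff_eval {F : MvPowerSeries σ ℝ} (hF : F ∈ nonnegCoeffs σ ℝ) {x : σ → ℝ}
    (hx : ∀ s, 0 ≤ x s) {v : ℝ} (hv : 0 ≤ v) :
    HasSum (fun d => MvPowerSeries.coeff d F * d.prod fun s e => x s ^ e) v ↔
      eval F (fun s => ENNReal.ofReal (x s)) = ENNReal.ofReal v := by
  have hmonomial (d : σ →₀ ℕ) (s : σ) : 0 ≤ x s ^ d s := pow_nonneg (hx s) _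
  simp only [Finsupp.prod]
  rw [hasSum_iff_tsum_ofReal
    (fun d => mul_nonneg (hF d) (Finset.prod_nonneg fun s _ => hmonomial d s)) hv, eval]
  simp only [ENNReal.ofReal_mul (hF _), Finsupp.prod,
    ENNReal.ofReal_prod_of_nonneg fun s _ => hmonomial _ s, ENNReal.ofReal_pow (hx _)]

theorem hasValue_iff_eval {F : MvPowerSeries (Fin 2) ℝ} (hF : F ∈ nonnegCoeffs (Fin 2) ℝ)
    {a b v : ℝ} (ha : 0 ≤ a) (hb : 0 ≤ b) (hv : 0 ≤ v) :
    HasValue F a b v ↔ eval F ![ENNReal.ofReal a, ENNReal.ofReal b] = ENNReal.ofReal v := by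
  have h := hasSum_iff_eval hF (x := ![a, b]) (Fin.forall_fin_two.2 ⟨ha, hb⟩) hv
  simp only [Finsupp.prod_fintype _ _ fun _ => pow_zero _, Fin.prod_univ_two, ← mul_assoc] at h
  rw [show ![ENNReal.ofReal a, ENNReal.ofReal b] = fun s => ENNReal.ofReal (![a, b] s) from
    funext (Fin.forall_fin_two.2 ⟨rfl, rfl⟩)]
  exact h

theorem eval_powerSeries (T : ℝ⟦X⟧) (x : Unit → ℝ≥0∞) :
    eval T x = ∑' n, ENNReal.ofReal (PowerSeries.coeff n T) * x () ^ n := by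
  rw [eval, ← (Finsupp.uniqueEquiv ()).symm.tsum_eq]
  refine tsum_congr fun n => ?_
  simp [PowerSeries.coeff]

theorem hasSum_powerSeries_iff_eval {T : ℝ⟦X⟧} (hT : T ∈ nonnegCoeffs Unit ℝ) {a v : ℝ}
    (ha : 0 ≤ a) (hv : 0 ≤ v) :
    HasSum (fun n => PowerSeries.coeff n T * a ^ n) v ↔
      eval T (fun _ => ENNReal.ofReal a) = ENNReal.ofReal v := by
  have hT' := mem_nonnegCoeffs_unit_iff.1 hT
  rw [hasSum_iff_tsum_ofReal (fun n => mul_nonneg (hT' n) (pow_nonneg ha n)) hv, eval_powerSeries]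
  simp only [ENNReal.ofReal_mul (hT' _), ENNReal.ofReal_pow ha]

theorem eval_lt_eval_of_lt {T : ℝ⟦X⟧} (hT : PowerSeries.constantCoeff T = 0) {x y : ℝ≥0∞}
    (hxy : x < y) (hpos : eval T (fun _ => x) ≠ 0) (hfin : eval T (fun _ => x) ≠ ∞) :
    eval T (fun _ => x) < eval T fun _ => y := by
  rw [eval_powerSeries] at hpos hfin
  rw [eval_powerSeries, eval_powerSeries]
  obtain ⟨n, hn⟩ : ∃ n, ENNReal.ofReal (PowerSeries.coeff n T) * x ^ n ≠ 0 := by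
    simpa using hpos
  have hn₀ : n ≠ 0 := by
    rintro rfl
    simp [hT] at hn
  refine ENNReal.tsum_lt_tsum (i := n) hfin (fun m => by gcongr) ?_
  exact ENNReal.mul_lt_mul_right (left_ne_zero_of_mul hn) ENNReal.ofReal_ne_top
    (ENNReal.pow_lt_pow_left hn₀ hxy)

end Evaluation

section StandardSolution

variable {G : MvPowerSeries (Fin 2) ℝ} {T : ℝ⟦X⟧}

theorem eval_substSnd (hG : G ∈ nonnegCoeffs (Fin 2) ℝ) (hT₀ : PowerSeries.constantCoeff T = 0)
    (hT : T ∈ nonnegCoeffs Unit ℝ) (x : ℝ≥0∞) :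
    eval (substSnd G T) (fun _ => x) = eval G ![x, eval T fun _ => x] := by
  rw [substSnd, eval_subst hG (hasSubst_X_cons hT₀) (X_cons_mem_nonnegCoeffs hT)]
  exact congrArg (eval G) (funext (Fin.forall_fin_two.2 ⟨eval_X () _, rfl⟩))

/-- The formal power series `T` that satisfy the conditions of a standard solution other than the
equation and take a value `T(x) ≤ y`. If `G(x, y) ≤ y`, then `T ↦ G(x, T(x))` maps this set to
itself. -/
def candidates (x y : ℝ≥0∞) : Set ℝ⟦X⟧ :=
  {T | PowerSeries.constantCoeff T = 0 ∧ T ∈ nonnegCoeffs Unit ℝ ∧ eval T (fun _ => x) ≤ y}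

theorem zero_mem_candidates (x y : ℝ≥0∞) : 0 ∈ candidates x y :=
  ⟨map_zero _, zero_mem _, (eval_zero _).trans_le zero_le⟩

theorem mapsTo_substSnd_candidates (hG : G ∈ nonnegCoeffs (Fin 2) ℝ)
    (hX : MvPowerSeries.X 0 ∣ G) {x y : ℝ≥0∞} (hxy : eval G ![x, y] ≤ y) :
    Set.MapsTo (substSnd G) (candidates x y) (candidates x y) := by
  rintro T ⟨hT₀, hT, hTy⟩
  refine ⟨constantCoeff_substSnd hX hT₀,
    subst_mem_nonnegCoeffs hG (hasSubst_X_cons hT₀) (X_cons_mem_nonnegCoeffs hT), ?_⟩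
  rw [eval_substSnd hG hT₀ hT]
  have hle : ![x, eval T fun _ => x] ≤ ![x, y] := Fin.forall_fin_two.2 ⟨le_rfl, hTy⟩
  exact (eval_mono G hle).trans hxy

theorem isAdicClosed_candidates (x y : ℝ≥0∞) :
    IsAdicClosed (Ideal.span {(PowerSeries.X : ℝ⟦X⟧)}) (candidates x y) := by
  intro T hT
  simp only [smodEq_span_X_pow_iff] at hT
  refine ⟨?_, mem_nonnegCoeffs_unit_iff.2 fun n => ?_, ?_⟩
  · obtain ⟨S, hS, hTS⟩ := hT 1
    simpa only [PowerSeries.coeff_zero_eq_constantCoeff_apply, hS.1] using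
      coeff_eq_of_X_pow_dvd_sub hTS one_pos
  · obtain ⟨S, hS, hTS⟩ := hT (n + 1)
    rw [coeff_eq_of_X_pow_dvd_sub hTS n.lt_succ_self]
    exact mem_nonnegCoeffs_unit_iff.1 hS.2.1 n
  · rw [eval_powerSeries]
    refine ENNReal.tsum_le_of_sum_range_le fun n => ?_
    obtain ⟨S, hS, hTS⟩ := hT n
    calc ∑ m ∈ Finset.range n, ENNReal.ofReal (PowerSeries.coeff m T) * x ^ m
        = ∑ m ∈ Finset.range n, ENNReal.ofReal (PowerSeries.coeff m S) * x ^ m :=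
          Finset.sum_congr rfl fun m hm => by
            rw [coeff_eq_of_X_pow_dvd_sub hTS (Finset.mem_range.1 hm)]
      _ ≤ eval S fun _ => x := (ENNReal.sum_le_tsum _).trans_eq (eval_powerSeries S fun _ => x).symm
      _ ≤ y := hS.2.2

theorem exists_isStandardSolution_eval_le (hG : G ∈ nonnegCoeffs (Fin 2) ℝ)
    (hX : MvPowerSeries.X 0 ∣ G) {x y : ℝ≥0∞} (hxy : eval G ![x, y] ≤ y) :
    ∃ T, IsStandardSolution G T ∧ eval T (fun _ => x) ≤ y := by
  obtain ⟨T, ⟨hT₀, hT, hTy⟩, hfix⟩ :=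
    ((adicContractingOn_substSnd hX).mono fun _ h => h.1).exists_isFixedPt
      (isAdicClosed_candidates x y) ⟨0, zero_mem_candidates x y⟩
      (mapsTo_substSnd_candidates hG hX hxy)
  exact ⟨T, ⟨mem_nonnegCoeffs_unit_iff.1 hT, hT₀, hfix.symm⟩, hTy⟩

theorem IsStandardSolution.mem_nonnegCoeffs (hT : IsStandardSolution G T) :
    T ∈ nonnegCoeffs Unit ℝ :=
  mem_nonnegCoeffs_unit_iff.2 hT.nonneg

theorem IsStandardSolution.unique (hX : MvPowerSeries.X 0 ∣ G) {S : ℝ⟦X⟧}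
    (hS : IsStandardSolution G S) (hT : IsStandardSolution G T) : S = T :=
  (adicContractingOn_substSnd hX).eq_of_isFixedPt hS.constantCoeff_eq_zero
    hT.constantCoeff_eq_zero hS.eq_subst.symm hT.eq_subst.symm

theorem IsStandardSolution.eval_eq (hG : G ∈ nonnegCoeffs (Fin 2) ℝ)
    (hT : IsStandardSolution G T) (x : ℝ≥0∞) :
    eval G ![x, eval T fun _ => x] = eval T fun _ => x := by
  rw [← eval_substSnd hG hT.constantCoeff_eq_zero hT.mem_nonnegCoeffs, substSnd, ← hT.eq_subst]

theorem IsStandardSolution.eval_le (hG : G ∈ nonnegCoeffs (Fin 2) ℝ)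
    (hX : MvPowerSeries.X 0 ∣ G) (hT : IsStandardSolution G T) {x y : ℝ≥0∞}
    (hxy : eval G ![x, y] ≤ y) : eval T (fun _ => x) ≤ y := by
  obtain ⟨S, hS, hSy⟩ := exists_isStandardSolution_eval_le hG hX hxy
  rwa [hT.unique hX hS]

end StandardSolution

section Tangent

variable {F G : MvPowerSeries (Fin 2) ℝ}

theorem pow_add_mul_lt_add_pow {R : Type*} [CommRing R] [LinearOrder R] [IsStrictOrderedRing R]
    {a b : R} (ha : 0 < a) (hb : b ≠ 0) (hab : 0 ≤ a + b) {n : ℕ} (hn : 2 ≤ n) :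
    a ^ n + n * a ^ (n - 1) * b < (a + b) ^ n := by
  obtain ⟨k, rfl⟩ := Nat.exists_eq_add_of_le' hn
  have hsq : 0 < ((k + 1 : ℕ) : R) * a ^ k * b ^ 2 := by positivity
  have hbernoulli : a ^ (k + 1) + (k + 1 : ℕ) * a ^ k * b ≤ (a + b) ^ (k + 1) :=
    pow_add_mul_le_add_pow ha.le (by linarith) (k + 1)
  calc a ^ (k + 2) + (k + 2 : ℕ) * a ^ (k + 1) * b
      < a ^ (k + 2) + (k + 2 : ℕ) * a ^ (k + 1) * b + (k + 1 : ℕ) * a ^ k * b ^ 2 :=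
        lt_add_of_pos_right _ hsq
    _ = (a ^ (k + 1) + (k + 1 : ℕ) * a ^ k * b) * (a + b) := by push_cast; ring
    _ ≤ (a + b) ^ (k + 1) * (a + b) := mul_le_mul_of_nonneg_right hbernoulli hab
    _ = (a + b) ^ (k + 2) := (pow_succ _ _).symm

theorem HasValue.hasSum_dy {a b w : ℝ} (h : HasValue (dy F) a b w) :
    HasSum (fun d : Fin 2 →₀ ℕ =>
      MvPowerSeries.coeff d F * a ^ d 0 * (d 1 * b ^ (d 1 - 1))) w := by
  have hinj : Function.Injective fun d : Fin 2 →₀ ℕ => d + Finsupp.single 1 1 :=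
    add_left_injective _
  refine (hinj.hasSum_iff fun d hd => ?_).1 ?_
  · have hd₁ : d 1 = 0 := by
      by_contra hne
      refine hd ⟨d - Finsupp.single 1 1, tsub_add_cancel_of_le ?_⟩
      exact Finsupp.single_le_iff.2 (Nat.one_le_iff_ne_zero.2 hne)
    simp [hd₁]
  · refine h.congr_fun fun d => ?_
    simp only [dy, MvPowerSeries.coeff_pderiv, Function.comp_apply, Finsupp.add_apply, ne_eq,
      zero_ne_one, not_false_eq_true, Finsupp.single_eq_of_ne, Finsupp.single_eq_same, add_zero,
      Nat.cast_add, Nat.cast_one, add_tsub_cancel_right]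
    ring

theorem exists_coeff_ne_zero_of_dy_dy_ne_zero (h : dy (dy F) ≠ 0) :
    ∃ d : Fin 2 →₀ ℕ, 2 ≤ d 1 ∧ MvPowerSeries.coeff d F ≠ 0 := by
  obtain ⟨d, hd⟩ := (MvPowerSeries.ne_zero_iff_exists_coeff_ne_zero _).1 h
  simp only [dy, MvPowerSeries.coeff_pderiv] at hd
  exact ⟨d + Finsupp.single 1 1 + Finsupp.single 1 1, by simp,
    left_ne_zero_of_mul (left_ne_zero_of_mul hd)⟩

theorem HasValue.tangent_lt (hF : F ∈ nonnegCoeffs (Fin 2) ℝ) (hyy : dy (dy F) ≠ 0)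
    {a b y u v w : ℝ} (ha : 0 < a) (hb : 0 < b) (hy : 0 ≤ y) (hne : y ≠ b)
    (hu : HasValue F a b u) (hw : HasValue (dy F) a b w) (hv : HasValue F a y v) :
    u + w * (y - b) < v := by
  have htangent := hu.add (hw.hasSum_dy.mul_right (y - b))
  obtain ⟨d₀, hd₀, hcoeff⟩ := exists_coeff_ne_zero_of_dy_dy_ne_zero hyy
  have hpow (j : ℕ) : b ^ j + j * b ^ (j - 1) * (y - b) ≤ y ^ j := by
    simpa only [add_sub_cancel] using
      pow_add_mul_le_add_pow (a := b) (b := y - b) hb.le (by linarith) j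
  have hpow_lt : b ^ d₀ 1 + d₀ 1 * b ^ (d₀ 1 - 1) * (y - b) < y ^ d₀ 1 := by
    simpa only [add_sub_cancel] using
      pow_add_mul_lt_add_pow (b := y - b) hb (sub_ne_zero.2 hne) (by linarith) hd₀
  have hterm (d : Fin 2 →₀ ℕ) : MvPowerSeries.coeff d F * a ^ d 0 * b ^ d 1 +
      MvPowerSeries.coeff d F * a ^ d 0 * (d 1 * b ^ (d 1 - 1)) * (y - b) =
      MvPowerSeries.coeff d F * a ^ d 0 * (b ^ d 1 + d 1 * b ^ (d 1 - 1) * (y - b)) := by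
    ring
  simp only [hterm] at htangent
  exact hasSum_lt (i := d₀)
    (fun d => mul_le_mul_of_nonneg_left (hpow (d 1)) (mul_nonneg (hF d) (pow_nonneg ha.le _)))
    (mul_lt_mul_of_pos_left hpow_lt (mul_pos ((hF d₀).lt_of_ne' hcoeff) (pow_pos ha _)))
    htangent hv

theorem lt_eval_of_mem_charPoints (hG : G ∈ nonnegCoeffs (Fin 2) ℝ) (hyy : dy (dy G) ≠ 0)
    {a b : ℝ} (hab : (a, b) ∈ charPoints G) {y : ℝ≥0∞} (hy : y ≠ ∞) (hne : y ≠ ENNReal.ofReal b) :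
    y < eval G ![ENNReal.ofReal a, y] := by
  obtain ⟨ha, hb, hu, hw⟩ : 0 < a ∧ 0 < b ∧ HasValue G a b b ∧ HasValue (dy G) a b 1 := hab
  by_cases htop : eval G ![ENNReal.ofReal a, y] = ∞
  · exact htop ▸ hy.lt_top
  lift y to ℝ≥0 using hy
  have hne' : (y : ℝ) ≠ b := by
    rintro rfl
    exact hne (ENNReal.ofReal_coe_nnreal).symm
  have hv : HasValue G a y (eval G ![ENNReal.ofReal a, y]).toReal := by
    rw [hasValue_iff_eval hG ha.le y.coe_nonneg ENNReal.toReal_nonneg, ENNReal.ofReal_coe_nnreal,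
      ENNReal.ofReal_toReal htop]
  have hlt := hu.tangent_lt hG hyy ha hb y.coe_nonneg hne' hw hv
  rw [one_mul, add_sub_cancel] at hlt
  exact (ENNReal.lt_ofReal_iff_toReal_lt ENNReal.coe_ne_top).2 hlt |>.trans_eq
    (ENNReal.ofReal_toReal htop)

end Tangent

section ExtremePoint

theorem radius_eq_of_summable_of_not_summable {𝕜 E F : Type*} [NontriviallyNormedField 𝕜]
    [NormedAddCommGroup E] [NormedSpace 𝕜 E] [NormedAddCommGroup F] [NormedSpace 𝕜 F]
    (p : FormalMultilinearSeries 𝕜 E F) {r : ℝ≥0} (hr : Summable fun n => ‖p n‖ * (r : ℝ) ^ n)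
    (hlt : ∀ s : ℝ≥0, r < s → ¬ Summable fun n => ‖p n‖ * (s : ℝ) ^ n) : p.radius = r := by
  refine le_antisymm (ENNReal.le_of_forall_nnreal_lt fun s hs => ?_) (p.le_radius_of_summable hr)
  by_contra! hrs
  exact hlt s (ENNReal.coe_lt_coe.1 hrs) (p.summable_norm_mul_pow hs)

variable {G : MvPowerSeries (Fin 2) ℝ} {T : ℝ⟦X⟧} {a b : ℝ}

theorem IsStandardSolution.eval_eq_of_mem_charPoints (hG : G ∈ nonnegCoeffs (Fin 2) ℝ)
    (hX : MvPowerSeries.X 0 ∣ G) (hyy : dy (dy G) ≠ 0) (hT : IsStandardSolution G T)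
    (hab : (a, b) ∈ charPoints G) : eval T (fun _ => ENNReal.ofReal a) = ENNReal.ofReal b := by
  have hGab : eval G ![ENNReal.ofReal a, ENNReal.ofReal b] = ENNReal.ofReal b :=
    (hasValue_iff_eval hG hab.1.le hab.2.1.le hab.2.1.le).1 hab.2.2.1
  have hfin : eval T (fun _ => ENNReal.ofReal a) ≠ ∞ :=
    ne_top_of_le_ne_top ENNReal.ofReal_ne_top (hT.eval_le hG hX hGab.le)
  by_contra hne
  exact (lt_eval_of_mem_charPoints hG hyy hab hfin hne).ne' (hT.eval_eq hG _)

theorem IsStandardSolution.eval_eq_top_of_lt (hG : G ∈ nonnegCoeffs (Fin 2) ℝ)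
    (hX : MvPowerSeries.X 0 ∣ G) (hyy : dy (dy G) ≠ 0) (hT : IsStandardSolution G T)
    (hab : (a, b) ∈ charPoints G) {x : ℝ≥0∞} (hx : ENNReal.ofReal a < x) :
    eval T (fun _ => x) = ∞ := by
  by_contra hfin
  have hTa := hT.eval_eq_of_mem_charPoints hG hX hyy hab
  have hlt : ENNReal.ofReal b < eval T fun _ => x := by
    rw [← hTa]
    refine eval_lt_eval_of_lt hT.constantCoeff_eq_zero hx ?_ ?_ <;> rw [hTa]
    exacts [(ENNReal.ofReal_pos.2 hab.2.1).ne', ENNReal.ofReal_ne_top]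
  refine lt_irrefl (eval T fun _ => x) ?_
  calc eval T (fun _ => x)
      < eval G ![ENNReal.ofReal a, eval T fun _ => x] :=
        lt_eval_of_mem_charPoints hG hyy hab hfin hlt.ne'
    _ ≤ eval G ![x, eval T fun _ => x] := eval_mono G (Fin.forall_fin_two.2 ⟨hx.le, le_rfl⟩)
    _ = eval T fun _ => x := hT.eval_eq hG x

theorem IsStandardSolution.isExtremePoint (hG : G ∈ nonnegCoeffs (Fin 2) ℝ)
    (hX : MvPowerSeries.X 0 ∣ G) (hyy : dy (dy G) ≠ 0) (hT : IsStandardSolution G T)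
    (hab : (a, b) ∈ charPoints G) : IsExtremePoint T a b := by
  have hasSum_iff {x v : ℝ} (hx : 0 ≤ x) (hv : 0 ≤ v) :=
    hasSum_powerSeries_iff_eval hT.mem_nonnegCoeffs hx hv
  have ha : 0 ≤ a := hab.1.le
  have hsum : HasSum (fun n => PowerSeries.coeff n T * a ^ n) b :=
    (hasSum_iff ha hab.2.1.le).2 (hT.eval_eq_of_mem_charPoints hG hX hyy hab)
  refine ⟨hab.1, radius_eq_of_summable_of_not_summable _ ?_ fun x hx => ?_, hsum⟩ <;>
    simp only [FormalMultilinearSeries.ofScalars_norm, Real.norm_of_nonneg (hT.nonneg _)]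
  · simpa only [Real.coe_toNNReal a ha] using hsum.summable
  · rintro ⟨v, hv⟩
    have hv₀ : 0 ≤ v := hv.nonneg fun n => mul_nonneg (hT.nonneg n) (pow_nonneg x.coe_nonneg n)
    have htop := hT.eval_eq_top_of_lt hG hX hyy hab (ENNReal.coe_lt_coe.2 hx)
    rw [hasSum_iff x.coe_nonneg hv₀, ENNReal.ofReal_coe_nnreal, htop] at hv
    exact ENNReal.ofReal_ne_top hv.symm

theorem IsExtremePoint.unique {ρ τ ρ' τ' : ℝ} (h : IsExtremePoint T ρ τ)
    (h' : IsExtremePoint T ρ' τ') : ρ = ρ' ∧ τ = τ' := by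
  obtain rfl : ρ = ρ' := (ENNReal.ofReal_eq_ofReal_iff h.pos.le h'.pos.le).1
    (h.radius_eq.symm.trans h'.radius_eq)
  exact ⟨rfl, h.hasSum.unique h'.hasSum⟩

end ExtremePoint

theorem WellConditioned.X_zero_dvd {G : MvPowerSeries (Fin 2) ℝ} (hG : WellConditioned G) :
    MvPowerSeries.X 0 ∣ G := by
  refine MvPowerSeries.X_dvd_iff.2 fun d hd => ?_
  have hsingle : d = Finsupp.single 1 (d 1) := by
    ext i
    fin_cases i <;> simp [hd]
  rw [hsingle]
  exact hG.zero_left (d 1)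

end OneEq

theorem mainTheorem5_general (G : MvPowerSeries (Fin 2) ℝ)
    (hG : G ∈ OneEq.nonnegCoeffs (Fin 2) ℝ) (hX : MvPowerSeries.X 0 ∣ G)
    (hyy : OneEq.dy (OneEq.dy G) ≠ 0) :
    (OneEq.charPoints G).Subsingleton ∧
    ∃ T : PowerSeries ℝ, OneEq.IsStandardSolution G T ∧
      (∀ S : PowerSeries ℝ, OneEq.IsStandardSolution G S → S = T) ∧
      ∀ p ∈ OneEq.charPoints G, OneEq.IsExtremePoint T p.1 p.2 := by
  obtain ⟨T, hT, -⟩ :=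
    OneEq.exists_isStandardSolution_eval_le hG hX (le_top : OneEq.eval G ![0, ∞] ≤ ∞)
  have hextreme (p) (hp : p ∈ OneEq.charPoints G) : OneEq.IsExtremePoint T p.1 p.2 :=
    hT.isExtremePoint hG hX hyy hp
  refine ⟨fun p hp q hq => ?_, T, hT, fun S hS => hS.unique hX hT, hextreme⟩
  obtain ⟨h₁, h₂⟩ := (hextreme p hp).unique (hextreme q hq)
  exact Prod.ext h₁ h₂

theorem mainTheorem5 (G : MvPowerSeries (Fin 2) ℝ) (hG : OneEq.WellConditioned G) :
    (OneEq.charPoints G).Subsingleton ∧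
    ∃ T : PowerSeries ℝ, OneEq.IsStandardSolution G T ∧
      (∀ S : PowerSeries ℝ, OneEq.IsStandardSolution G S → S = T) ∧
      ∀ p ∈ OneEq.charPoints G, OneEq.IsExtremePoint T p.1 p.2 :=
  mainTheorem5_general G hG.nonneg hG.X_zero_dvd hG.nonlinear
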